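/- Let $X$, $Y$, $\partial X$ be complex Banach spaces with $Y\hookrightarrow X$ (continuous injective embedding). Let $A:D(A)\to X$ be a linear operator with domain $D(A)\subset X$ such that $D(A)\subset Y$, let $L:D(A)\to\partial X$ be linear and surjective, and assume that $A_0:=A|_{\ker L}$ is closed, densely defined in $X$ and has nonempty resolvent set, and that $\binom{A}{L}:D(A)\subset X\to X\times\partial X$ is closed. Let $B:D(A)\to\partial X$ be linear and bounded with respect to the graph norm $\|u\|_X+\|Au\|_X+\|Lu\|_{\partial X}$, and let $\tilde B$ be a bounded linear operator on $\partial X$. On $X\times\partial X$ consider the operator $$\mathcal A\begin{pmatrix}u\\x\end{pmatrix}=\begin{pmatrix}Au\\Bu+\tilde Bx\end{pmatrix},\qquad D(\mathcal A)=\left\{\begin{pmatrix}u\\x\end{pmatrix}\in D(A)\times\partial X: Lu=x\right\}.$$ A cosine operator function on a Banach space $E$ is a strongly continuous map $C:\mathbb R\to\mathcal L(E)$ with $C(0)=I$ and $C(t+s)+C(t-s)=2C(t)C(s)$ for all $t,s\in\mathbb R$; its generator is $Kx=\lim_{t\to0}\frac2{t^2}(C(t)x-x)$, defined on the set of all $x\in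 E$ for which this limit exists. For $f,g\in X$ and $h,j\in\partial X$, a classical solution of the problem $$\ddot u(t)=Au(t),\quad \ddot x(t)=Bu(t)+\tilde Bx(t),\quad x(t)=Lu(t)\quad(t\in\mathbb R),$$ $$u(0)=f,\quad \dot u(0)=g,\quad x(0)=h,\quad \dot x(0)=j$$ is a function $u\in C^2(\mathbb R,X)\cap C^1(\mathbb R,Y)$ with $u(t)\in D(A)$ for all $t\in\mathbb R$ and $Lu(\cdot)\in C^2(\mathbb R,\partial X)$ that satisfies the problem. Let $D(A^\infty)=\bigcap_{n\ge0}D(A^n)$ and $$\mathcal D_0^\infty=\bigcap_{n=0}^\infty\{u\in D(A^\infty): LA^nu=BA^nu=0\}.$$ **Proposition.** Assume that $\mathcal A$ generates a cosine operator function on $X\times\partial X$. If $f,g\in\mathcal D_0^\infty$ and $h=j=0$, then the problem has a unique classical solution $u$, and $u(t)\in D(A^\infty)$ for all $t\in\mathbb R$. -/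

import Mathlib

open Filter Topology

noncomputable section

namespace SecondOrderBVP

/-! ### Cosine operator functions and their generators -/

section Cosine

variable {E : Type*} [NormedAddCommGroup E] [NormedSpace ℂ E]

/-- `C : ℝ → 𝓛(E)` is a cosine operator function: it is strongly continuous and satisfies the
D'Alembert functional relations. -/
structure IsCosineFunction (C : ℝ → E →L[ℂ] E) : Prop where
  strongly_continuous : ∀ x : E, Continuous fun t : ℝ => C t x
  dalembert : ∀ t s : ℝ, C (t + s) + C (t - s) = (2 : ℂ) • (C t ∘L C s)
  zero : C 0 = ContinuousLinearMap.id ℂ E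

/-- The operator `K` is the generator of `C`: `K x = lim_{t → 0} (2 / t²) (C(t) x - x)`, with domain
the set of all `x` for which this limit exists. Equivalently, `(x, y)` lies in the graph of `K` if
and only if `(2 / t²) (C(t) x - x)` converges to `y` as `t → 0`. -/
def IsGeneratorOf (K : E →ₗ.[ℂ] E) (C : ℝ → E →L[ℂ] E) : Prop :=
  ∀ x y : E, (x, y) ∈ K.graph ↔
    Tendsto (fun t : ℝ => ((2 / t ^ 2 : ℝ) : ℂ) • (C t x - x)) (𝓝[≠] 0) (𝓝 y)

/-- The operator `K` generates a cosine operator function on `E`. -/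
def GeneratesCosine (K : E →ₗ.[ℂ] E) : Prop :=
  ∃ C : ℝ → E →L[ℂ] E, IsCosineFunction C ∧ IsGeneratorOf K C

end Cosine

/-! ### Unbounded operators: resolvent set, powers, `D(A^∞)` -/

section Operators

variable {X : Type*} [NormedAddCommGroup X] [NormedSpace ℂ X]

/-- `lam` lies in the resolvent set of `K`: the operator `lam - K : D(K) → X` is bijective with an
everywhere defined bounded inverse `R`. -/
def IsInResolventSet (K : X →ₗ.[ℂ] X) (lam : ℂ) : Prop :=
  ∃ R : X →L[ℂ] X,
    (∀ x : X, ∃ h : R x ∈ K.domain, lam • R x - K ⟨R x, h⟩ = x) ∧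
    (∀ u : K.domain, R (lam • (u : X) - K u) = u)

/-- The composition `K ∘ P` with its natural domain `{u ∈ D(P) : P u ∈ D(K)}`. -/
def compNat (K P : X →ₗ.[ℂ] X) : X →ₗ.[ℂ] X where
  domain :=
    { carrier := {u | ∃ h : u ∈ P.domain, P ⟨u, h⟩ ∈ K.domain}
      zero_mem' := ⟨P.domain.zero_mem, by
        have h : P ⟨0, P.domain.zero_mem⟩ = 0 := P.map_zero
        rw [h]; exact K.domain.zero_mem⟩
      add_mem' := by
        rintro u v ⟨hu, hu'⟩ ⟨hv, hv'⟩
        refine ⟨P.domain.add_mem hu hv, ?_⟩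
        have h : P ⟨u + v, P.domain.add_mem hu hv⟩ = P ⟨u, hu⟩ + P ⟨v, hv⟩ :=
          P.map_add ⟨u, hu⟩ ⟨v, hv⟩
        rw [h]; exact K.domain.add_mem hu' hv'
      smul_mem' := by
        rintro c u ⟨hu, hu'⟩
        refine ⟨P.domain.smul_mem c hu, ?_⟩
        have h : P ⟨c • u, P.domain.smul_mem c hu⟩ = c • P ⟨u, hu⟩ :=
          P.map_smul c ⟨u, hu⟩
        rw [h]; exact K.domain.smul_mem c hu' }
  toFun :=
    { toFun := fun u => K ⟨P ⟨u, u.2.1⟩, u.2.2⟩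
      map_add' := fun u v => by
        rw [← K.map_add]
        exact congrArg K (Subtype.ext (P.map_add ⟨u, u.2.1⟩ ⟨v, v.2.1⟩))
      map_smul' := fun c u => by
        rw [RingHom.id_apply, ← K.map_smul]
        exact congrArg K (Subtype.ext (P.map_smul c ⟨u, u.2.1⟩)) }

/-- The `n`-th power `Aⁿ` with its natural domain: `A⁰` is the identity on `X`, and
`Aⁿ⁺¹ = A ∘ Aⁿ` on `D(Aⁿ⁺¹) = {u ∈ D(Aⁿ) : Aⁿ u ∈ D(A)}`. -/
def opPow (A : X →ₗ.[ℂ] X) : ℕ → (X →ₗ.[ℂ] X)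
  | 0 => (LinearMap.id : X →ₗ[ℂ] X).toPMap ⊤
  | n + 1 => compNat A (opPow A n)

/-- `D(A^∞)`, the intersection of the domains of all powers of `A`. -/
def domInfty (A : X →ₗ.[ℂ] X) : Submodule ℂ X := ⨅ n : ℕ, (opPow A n).domain

end Operators

/-! ### The abstract initial-boundary value problem -/

section Problem

variable {X Y bX : Type*}
  [NormedAddCommGroup X] [NormedSpace ℂ X]
  [NormedAddCommGroup Y] [NormedSpace ℂ Y]
  [NormedAddCommGroup bX] [NormedSpace ℂ bX]

/-- `A₀`, the restriction of `A` to `ker L ⊆ D(A)`. -/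
def restrictKer (A : X →ₗ.[ℂ] X) (L : A.domain →ₗ[ℂ] bX) : X →ₗ.[ℂ] X where
  domain := (LinearMap.ker L).map A.domain.subtype
  toFun := A.toFun ∘ₗ Submodule.inclusion (Submodule.map_subtype_le A.domain (LinearMap.ker L))

/-- The operator `u ↦ (A u, L u)` from `D(A) ⊆ X` to `X × ∂X`. -/
def stacked (A : X →ₗ.[ℂ] X) (L : A.domain →ₗ[ℂ] bX) : X →ₗ.[ℂ] (X × bX) where
  domain := A.domain
  toFun := A.toFun.prod L

/-- The operator matrix `𝒜 (u, x) = (A u, B u + B̃ x)` on `X × ∂X` with coupled domain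
`D(𝒜) = {(u, x) ∈ D(A) × ∂X : L u = x}`. -/
def opMatrix (A : X →ₗ.[ℂ] X) (L B : A.domain →ₗ[ℂ] bX) (Bt : bX →L[ℂ] bX) :
    (X × bX) →ₗ.[ℂ] (X × bX) where
  domain :=
    { carrier := {p | ∃ h : p.1 ∈ A.domain, L ⟨p.1, h⟩ = p.2}
      zero_mem' := ⟨A.domain.zero_mem, L.map_zero⟩
      add_mem' := by
        rintro p q ⟨hp, hp'⟩ ⟨hq, hq'⟩
        refine ⟨A.domain.add_mem hp hq, ?_⟩
        rw [Prod.snd_add, ← hp', ← hq']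
        exact L.map_add ⟨p.1, hp⟩ ⟨q.1, hq⟩
      smul_mem' := by
        rintro c p ⟨hp, hp'⟩
        refine ⟨A.domain.smul_mem c hp, ?_⟩
        rw [Prod.smul_snd, ← hp']
        exact L.map_smul c ⟨p.1, hp⟩ }
  toFun :=
    { toFun := fun p => (A ⟨p.1.1, p.2.1⟩, B ⟨p.1.1, p.2.1⟩ + Bt p.1.2)
      map_add' := fun p q => by
        have h1 : A ⟨(p + q).1.1, (p + q).2.1⟩ = A ⟨p.1.1, p.2.1⟩ + A ⟨q.1.1, q.2.1⟩ :=
          A.map_add ⟨p.1.1, p.2.1⟩ ⟨q.1.1, q.2.1⟩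
        have h2 : B ⟨(p + q).1.1, (p + q).2.1⟩ = B ⟨p.1.1, p.2.1⟩ + B ⟨q.1.1, q.2.1⟩ :=
          B.map_add ⟨p.1.1, p.2.1⟩ ⟨q.1.1, q.2.1⟩
        have h3 : Bt (p + q).1.2 = Bt p.1.2 + Bt q.1.2 := Bt.map_add p.1.2 q.1.2
        rw [h1, h2, h3, Prod.mk_add_mk, add_add_add_comm]
      map_smul' := fun c p => by
        have h1 : A ⟨(c • p).1.1, (c • p).2.1⟩ = c • A ⟨p.1.1, p.2.1⟩ :=
          A.map_smul c ⟨p.1.1, p.2.1⟩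
        have h2 : B ⟨(c • p).1.1, (c • p).2.1⟩ = c • B ⟨p.1.1, p.2.1⟩ :=
          B.map_smul c ⟨p.1.1, p.2.1⟩
        have h3 : Bt (c • p).1.2 = c • Bt p.1.2 := Bt.map_smul c p.1.2
        rw [h1, h2, h3, RingHom.id_apply, Prod.smul_mk, smul_add] }

/-- The set `𝒟₀^∞` of all `u ∈ D(A^∞)` such that `L Aⁿ u = B Aⁿ u = 0` for every `n ≥ 0`. -/
def regularData (A : X →ₗ.[ℂ] X) (L B : A.domain →ₗ[ℂ] bX) : Set X :=
  {u | u ∈ domInfty A ∧ ∀ n : ℕ, ∃ (hn : u ∈ (opPow A n).domain)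
    (h : opPow A n ⟨u, hn⟩ ∈ A.domain),
      L ⟨opPow A n ⟨u, hn⟩, h⟩ = 0 ∧ B ⟨opPow A n ⟨u, hn⟩, h⟩ = 0}

/-- `u` is a classical solution of the initial-boundary value problem
`ü = A u`, `ẍ = B u + B̃ x`, `x = L u` on `ℝ`, with `u(0) = f`, `u̇(0) = g`, `x(0) = h`, `ẋ(0) = j`.
Here the Banach space `Y` is embedded into `X` by `ι`. -/
structure IsClassicalSolution (ι : Y →L[ℂ] X) (A : X →ₗ.[ℂ] X) (L B : A.domain →ₗ[ℂ] bX)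
    (Bt : bX →L[ℂ] bX) (f g : X) (h j : bX) (u : ℝ → X) : Prop where
  contDiff : ContDiff ℝ 2 u
  /-- `u ∈ C¹(ℝ, Y)` -/
  contDiff_Y : ∃ v : ℝ → Y, ContDiff ℝ 1 v ∧ ∀ t, ι (v t) = u t
  mem_domain : ∀ t, u t ∈ A.domain
  contDiff_L : ContDiff ℝ 2 fun t => L ⟨u t, mem_domain t⟩
  eq_interior : ∀ t, deriv (deriv u) t = A ⟨u t, mem_domain t⟩
  eq_boundary : ∀ t, deriv (deriv fun s => L ⟨u s, mem_domain s⟩) t =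
    B ⟨u t, mem_domain t⟩ + Bt (L ⟨u t, mem_domain t⟩)
  init_u : u 0 = f
  init_du : deriv u 0 = g
  init_x : L ⟨u 0, mem_domain 0⟩ = h
  init_dx : deriv (fun s => L ⟨u s, mem_domain s⟩) 0 = j

end Problem

end SecondOrderBVP

end

/-! The vanishing conditions make $(f,0)$ a $C^\infty$-vector of $\mathcal A$: $LA^nf=0$ puts
$(A^nf,0)$ in $D(\mathcal A)$, and $BA^nf=0$ gives $\mathcal A(A^nf,0)=(A^{n+1}f,0)$; likewise for
$g$. With $S$ the integral of the cosine function $C$, the curves $U_n=C(\cdot)\mathcal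
A^n(f,0)+S(\cdot)\mathcal A^n(g,0)$ satisfy $U_n''=U_{n+1}=\mathcal AU_n$. The first component of
$U_0$ is the solution $u$, and that of $U_n(t)$ is $A^nu(t)$, so $u(t)\in D(A^\infty)$.

Regularity in $Y$ comes from the closed graph theorem: $D(A)$ with the graph norm of $(A,L)$ embeds
continuously into $Y$ (`exists_continuous_lift`), and $u$ is $C^1$ in that norm. Uniqueness is
uniqueness for the Cauchy problem of $\mathcal A$ (`eq_zero_of_second_order`). As the generator is
only known as a limit at $0$, both parts rest on $C(t)x=x+\int_0^tS(s)Kx\,ds$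
(`apply_eq_add_sineIntegral`). -/

namespace SecondOrderBVP

/-! ### Second-order calculus at the origin. -/

section Calculus

variable {F : Type*} [NormedAddCommGroup F] [NormedSpace ℝ F]

theorem hasDerivAt_comp_neg {f : ℝ → F} {f' : F} {t : ℝ} (hf : HasDerivAt f f' (-t)) :
    HasDerivAt (fun s => f (-s)) (-f') t := by
  simpa [Function.comp_def] using hf.scomp t (hasDerivAt_neg t)

theorem eq_zero_of_hasDerivAt_zero {f : ℝ → F} (hf : ∀ t, HasDerivAt f 0 t) (h0 : f 0 = 0)
    (t : ℝ) : f t = 0 := by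
  rw [← h0]
  exact is_const_of_deriv_eq_zero (fun s => (hf s).differentiableAt) (fun s => (hf s).deriv) t 0

theorem eq_zero_of_hasDerivAt_twice {f f' : ℝ → F} (hf : ∀ t, HasDerivAt f (f' t) t)
    (hf' : ∀ t, HasDerivAt f' 0 t) (h0 : f 0 = 0) (h0' : f' 0 = 0) (t : ℝ) : f t = 0 :=
  eq_zero_of_hasDerivAt_zero
    (fun s => by simpa [eq_zero_of_hasDerivAt_zero hf' h0' s] using hf s) h0 t

theorem isLittleO_of_hasDerivAt_isLittleO {f f' : ℝ → F} (hf : ∀ t, HasDerivAt f (f' t) t)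
    (h0 : f 0 = 0) {n : ℕ} (h : f' =o[𝓝 0] fun t : ℝ => t ^ n) :
    f =o[𝓝 0] fun t : ℝ => t ^ (n + 1) := by
  rw [Asymptotics.isLittleO_iff] at h ⊢
  intro c hc
  obtain ⟨δ, hδ, hball⟩ := Metric.eventually_nhds_iff_ball.1 (h hc)
  refine Metric.eventually_nhds_iff_ball.2 ⟨δ, hδ, fun t ht => ?_⟩
  have key := (convex_closedBall (0 : ℝ) |t|).norm_image_sub_le_of_norm_hasDerivWithin_le
    (f := f) (f' := f') (C := c * |t| ^ n) (x := 0) (y := t)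
    (fun s _ => (hf s).hasDerivWithinAt)
    (fun s hs => by
      have hs' : |s| ≤ |t| := by simpa using hs
      have ht' : |t| < δ := by simpa using ht
      refine (hball s (by simpa using hs'.trans_lt ht')).trans ?_
      rw [norm_pow, Real.norm_eq_abs]
      gcongr)
    (by simp) (by simp)
  rw [h0, sub_zero, sub_zero] at key
  rw [norm_pow, Real.norm_eq_abs, pow_succ, ← mul_assoc]
  exact key

/-- Second-order Taylor expansion in Peano form: `f'` need only be differentiable at `0`, and its
little-o estimate integrates by the mean value inequality. -/
theorem tendsto_two_div_sq_smul {f f' : ℝ → F} (hf : ∀ t, HasDerivAt f (f' t) t)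
    {x : F} (hf' : HasDerivAt f' x 0) (h0 : f 0 = 0) (h0' : f' 0 = 0) :
    Tendsto (fun t : ℝ => (2 / t ^ 2 : ℝ) • f t) (𝓝[≠] 0) (𝓝 x) := by
  have h1 : (fun t => f' t - t • x) =o[𝓝 0] fun t : ℝ => t ^ 1 := by
    simpa [h0'] using hasDerivAt_iff_isLittleO.1 hf'
  have h2 : (fun t => f t - (t ^ 2 / 2) • x) =o[𝓝 0] fun t : ℝ => t ^ 2 := by
    refine isLittleO_of_hasDerivAt_isLittleO (fun t => (hf t).sub ?_) (by simp [h0]) h1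
    simpa using ((hasDerivAt_pow 2 t).div_const 2).smul_const x
  have h3 := (h2.mono nhdsWithin_le_nhds : _ =o[𝓝[≠] (0 : ℝ)] _).tendsto_inv_smul_nhds_zero
  have h4 := (h3.const_smul (2 : ℝ)).add_const x
  rw [smul_zero, zero_add] at h4
  refine h4.congr' ?_
  filter_upwards [self_mem_nhdsWithin] with t ht
  have ht : t ≠ 0 := ht
  rw [smul_sub, smul_sub, smul_smul, smul_smul, smul_smul]
  have : (2 * (t ^ 2)⁻¹ * (t ^ 2 / 2) : ℝ) = 1 := by field_simp
  rw [this, one_smul, sub_add_cancel, div_eq_mul_inv]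

end Calculus

/-! ### Strongly continuous operator families. -/

section StrongIntegral

variable {E : Type*} [NormedAddCommGroup E] [NormedSpace ℂ E] [CompleteSpace E]

theorem exists_bound_of_strongly_continuous {T : ℝ → E →L[ℂ] E}
    (hT : ∀ x, Continuous fun t => T t x) (R : ℝ) :
    ∃ M, 0 ≤ M ∧ ∀ t, |t| ≤ R → ‖T t‖ ≤ M := by
  obtain ⟨M, hM⟩ := banach_steinhaus (g := fun t : Metric.closedBall (0 : ℝ) R => T t) (fun x => by
    obtain ⟨c, hc⟩ := (isCompact_closedBall (0 : ℝ) R).exists_bound_of_continuousOn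
      (hT x).continuousOn
    exact ⟨c, fun t => hc t t.2⟩)
  exact ⟨max M 0, le_max_right _ _, fun t ht =>
    (hM ⟨t, by simpa using ht⟩).trans (le_max_left _ _)⟩

/-- The strong integral `x ↦ ∫₀ᵗ T(s) x ds` of a strongly continuous family of operators. -/
noncomputable def strongIntegral (T : ℝ → E →L[ℂ] E) (hT : ∀ x, Continuous fun t => T t x)
    (t : ℝ) : E →L[ℂ] E :=
  LinearMap.mkContinuousOfExistsBound
    { toFun := fun x => ∫ s in (0 : ℝ)..t, T s x
      map_add' := fun x y => by
        simp only [map_add]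
        exact intervalIntegral.integral_add ((hT x).intervalIntegrable _ _)
          ((hT y).intervalIntegrable _ _)
      map_smul' := fun c x => by
        simp only [map_smul, RingHom.id_apply]
        exact intervalIntegral.integral_smul c _ }
    (by
      obtain ⟨M, -, hM⟩ := exists_bound_of_strongly_continuous hT |t|
      refine ⟨M * |t|, fun x => ?_⟩
      have := intervalIntegral.norm_integral_le_of_norm_le_const (a := 0) (b := t)
        (f := fun s => T s x) (C := M * ‖x‖) (fun s hs => by
          refine (T s).le_of_opNorm_le (hM s ?_) x
          have := Set.abs_sub_left_of_mem_uIcc (Set.uIoc_subset_uIcc hs)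
          simpa using this)
      refine this.trans (le_of_eq ?_)
      rw [sub_zero]; ring)

variable {T : ℝ → E →L[ℂ] E} {hT : ∀ x, Continuous fun t => T t x}

theorem strongIntegral_apply (t : ℝ) (x : E) :
    strongIntegral T hT t x = ∫ s in (0 : ℝ)..t, T s x := rfl

@[simp] theorem strongIntegral_zero : strongIntegral T hT 0 = 0 := by
  ext x; simp [strongIntegral_apply]

theorem hasDerivAt_strongIntegral (x : E) (t : ℝ) :
    HasDerivAt (fun s => strongIntegral T hT s x) (T t x) t :=
  intervalIntegral.integral_hasDerivAt_right ((hT x).intervalIntegrable _ _)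
    ((hT x).stronglyMeasurableAtFilter _ _) (hT x).continuousAt

theorem continuous_strongIntegral (x : E) : Continuous fun s => strongIntegral T hT s x :=
  continuous_iff_continuousAt.2 fun t => (hasDerivAt_strongIntegral x t).continuousAt

theorem strongIntegral_comm (P : E →L[ℂ] E) (hP : ∀ s x, P (T s x) = T s (P x)) (t : ℝ) (x : E) :
    P (strongIntegral T hT t x) = strongIntegral T hT t (P x) := by
  simp only [strongIntegral_apply, ← hP]
  exact (P.intervalIntegral_comp_comm ((hT x).intervalIntegrable _ _)).symm

/-- Product rule for a strongly continuous family of operators applied to a curve. -/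
theorem hasDerivAt_apply_curve (hT : ∀ x, Continuous fun t => T t x) {a : ℝ → E} {a' b : E}
    {s : ℝ} (ha : HasDerivAt a a' s) (hb : HasDerivAt (fun r => T r (a s)) b s) :
    HasDerivAt (fun r => T r (a r)) (b + T s a') s := by
  -- `T` need not be norm continuous; its local boundedness, from Banach–Steinhaus, suffices for
  -- passing to the limit in operator and slope together.
  have key : Tendsto (fun r => T r (slope a s r)) (𝓝[≠] s) (𝓝 (T s a')) := by
    obtain ⟨M, hM0, hM⟩ := exists_bound_of_strongly_continuous hT (|s| + 1)
    have h1 : Tendsto (fun r => slope a s r - a') (𝓝[≠] s) (𝓝 0) := by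
      simpa using (hasDerivAt_iff_tendsto_slope.1 ha).sub_const a'
    have h2 : Tendsto (fun r => T r (slope a s r - a')) (𝓝[≠] s) (𝓝 0) := by
      refine squeeze_zero_norm' (a := fun r => M * ‖slope a s r - a'‖) ?_
        (by simpa using h1.norm.const_mul M)
      have : ∀ᶠ r in 𝓝[≠] s, |r| < |s| + 1 :=
        nhdsWithin_le_nhds ((continuous_abs.tendsto s).eventually_lt_const (by simp))
      filter_upwards [this] with r hr
      exact (T r).le_of_opNorm_le (hM r hr.le) _
    have h3 : Tendsto (fun r => T r a') (𝓝[≠] s) (𝓝 (T s a')) :=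
      ((hT a').tendsto s).mono_left nhdsWithin_le_nhds
    simpa using h2.add h3
  rw [hasDerivAt_iff_tendsto_slope] at hb ⊢
  refine (hb.add key).congr fun r => ?_
  have : T r (slope a s r) = (r - s)⁻¹ • (T r (a r) - T r (a s)) := by
    rw [slope_def_module, ← map_sub]
    exact (T r).map_smul_of_tower _ _
  rw [this, slope_def_module, slope_def_module, ← smul_add]
  congr 1
  abel

end StrongIntegral

end SecondOrderBVP

namespace SecondOrderBVP

/-! ### Cosine functions and the Cauchy problem of their generators. -/

section CosineTheory

variable {E : Type*} [NormedAddCommGroup E] [NormedSpace ℂ E]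
  {C : ℝ → E →L[ℂ] E} {K : E →ₗ.[ℂ] E}

namespace IsCosineFunction

theorem dalembert_apply (hC : IsCosineFunction C) (t s : ℝ) (x : E) :
    C (t + s) x + C (t - s) x = (2 : ℝ) • C t (C s x) := by
  have := congrArg (fun T : E →L[ℂ] E => T x) (hC.dalembert t s)
  simp only [_root_.add_apply, _root_.smul_apply,
    ContinuousLinearMap.comp_apply] at this
  rw [this, two_smul, two_smul]

theorem neg_apply (hC : IsCosineFunction C) (t : ℝ) (x : E) : C (-t) x = C t x := by
  have := hC.dalembert_apply 0 t x
  rw [hC.zero, ContinuousLinearMap.id_apply, two_smul, zero_add, zero_sub] at this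
  exact add_left_cancel this

theorem commute (hC : IsCosineFunction C) (t s : ℝ) (x : E) : C t (C s x) = C s (C t x) := by
  have h1 := hC.dalembert_apply t s x
  have h2 := hC.dalembert_apply s t x
  rw [← neg_sub t s, hC.neg_apply, add_comm s t] at h2
  exact smul_right_injective E (two_ne_zero (α := ℝ)) (h1.symm.trans h2)

variable [CompleteSpace E]

/-- The sine function `S(t) x = ∫₀ᵗ C(s) x ds`. -/
noncomputable def sine (hC : IsCosineFunction C) : ℝ → E →L[ℂ] E :=
  strongIntegral C hC.strongly_continuous

/-- The iterated integral `J(t) x = ∫₀ᵗ S(s) x ds`. -/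
noncomputable def sineIntegral (hC : IsCosineFunction C) : ℝ → E →L[ℂ] E :=
  strongIntegral hC.sine continuous_strongIntegral

theorem hasDerivAt_sine (hC : IsCosineFunction C) (x : E) (t : ℝ) :
    HasDerivAt (fun s => hC.sine s x) (C t x) t := hasDerivAt_strongIntegral x t

theorem hasDerivAt_sineIntegral (hC : IsCosineFunction C) (x : E) (t : ℝ) :
    HasDerivAt (fun s => hC.sineIntegral s x) (hC.sine t x) t := hasDerivAt_strongIntegral x t

theorem sine_zero (hC : IsCosineFunction C) : hC.sine 0 = 0 := strongIntegral_zero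

theorem sineIntegral_zero (hC : IsCosineFunction C) : hC.sineIntegral 0 = 0 := strongIntegral_zero

theorem sine_continuous (hC : IsCosineFunction C) (x : E) : Continuous fun t => hC.sine t x :=
  continuous_strongIntegral x

theorem sine_comm (hC : IsCosineFunction C) (h t : ℝ) (x : E) :
    C h (hC.sine t x) = hC.sine t (C h x) :=
  strongIntegral_comm (C h) (fun s y => hC.commute h s y) t x

theorem sineIntegral_comm (hC : IsCosineFunction C) (h t : ℝ) (x : E) :
    C h (hC.sineIntegral t x) = hC.sineIntegral t (C h x) :=
  strongIntegral_comm (C h) (fun s y => hC.sine_comm h s y) t x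

theorem sineIntegral_neg (hC : IsCosineFunction C) (t : ℝ) (x : E) :
    hC.sineIntegral (-t) x = hC.sineIntegral t x := by
  refine sub_eq_zero.1 (eq_zero_of_hasDerivAt_twice
    (f := fun t => hC.sineIntegral (-t) x - hC.sineIntegral t x)
    (f' := fun t => -hC.sine (-t) x - hC.sine t x)
    (fun s => (hasDerivAt_comp_neg (hC.hasDerivAt_sineIntegral x (-s))).sub
      (hC.hasDerivAt_sineIntegral x s))
    (fun s => ?_) (by simp) (by simp [hC.sine_zero]) t)
  have := (hasDerivAt_comp_neg (hC.hasDerivAt_sine x (-s))).neg.sub (hC.hasDerivAt_sine x s)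
  rwa [neg_neg, hC.neg_apply, sub_self] at this

/-- This is d'Alembert's relation integrated twice in `h`: value and first derivative agree at `h =
0`, second derivatives agree everywhere. -/
theorem sineIntegral_add (hC : IsCosineFunction C) (t h : ℝ) (x : E) :
    hC.sineIntegral (t + h) x + hC.sineIntegral (t - h) x =
      (2 : ℝ) • (hC.sineIntegral t x + C t (hC.sineIntegral h x)) := by
  let P : E →L[ℝ] E := (C t).restrictScalars ℝ
  have h1 : ∀ s, HasDerivAt (fun h => hC.sineIntegral (t + h) x + hC.sineIntegral (t - h) x -
      (2 : ℝ) • (hC.sineIntegral t x + P (hC.sineIntegral h x)))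
      (hC.sine (t + s) x + -hC.sine (t - s) x - (2 : ℝ) • P (hC.sine s x)) s := fun s => by
    refine ((HasDerivAt.comp_const_add t s (hC.hasDerivAt_sineIntegral x (t + s))).add
      (HasDerivAt.comp_const_sub t s (hC.hasDerivAt_sineIntegral x (t - s)))).sub ?_
    exact ((P.hasFDerivAt.comp_hasDerivAt s
      (hC.hasDerivAt_sineIntegral x s)).const_add _).const_smul _
  have h2 : ∀ s, HasDerivAt (fun s => hC.sine (t + s) x + -hC.sine (t - s) x -
      (2 : ℝ) • P (hC.sine s x)) 0 s := fun s => by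
    have := ((HasDerivAt.comp_const_add t s (hC.hasDerivAt_sine x (t + s))).add
      (HasDerivAt.comp_const_sub t s (hC.hasDerivAt_sine x (t - s))).neg).sub
      ((P.hasFDerivAt.comp_hasDerivAt s (hC.hasDerivAt_sine x s)).const_smul (2 : ℝ))
    refine this.congr_deriv ?_
    rw [neg_neg, hC.dalembert_apply]
    exact sub_self _
  refine sub_eq_zero.1 (eq_zero_of_hasDerivAt_twice h1 h2 ?_ ?_ h)
  · simp [sineIntegral_zero, two_smul]
  · simp [sine_zero]

/-- Since $J$ is even, the left side of `sineIntegral_add` is symmetric in `t` and `h`. -/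
theorem sineIntegral_swap (hC : IsCosineFunction C) (t h : ℝ) (x : E) :
    hC.sineIntegral t x + C t (hC.sineIntegral h x) =
      hC.sineIntegral h x + C h (hC.sineIntegral t x) := by
  refine smul_right_injective E (two_ne_zero (α := ℝ)) ?_
  have h1 := hC.sineIntegral_add t h x
  have h2 := hC.sineIntegral_add h t x
  rw [← neg_sub t h, hC.sineIntegral_neg, add_comm h t] at h2
  exact h1.symm.trans h2

theorem tendsto_sineIntegral (hC : IsCosineFunction C) (x : E) :
    Tendsto (fun t : ℝ => ((2 / t ^ 2 : ℝ) : ℂ) • hC.sineIntegral t x) (𝓝[≠] 0) (𝓝 x) := by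
  have h := hC.hasDerivAt_sine x 0
  rw [hC.zero, ContinuousLinearMap.id_apply] at h
  simpa only [Complex.coe_smul] using
    tendsto_two_div_sq_smul (hC.hasDerivAt_sineIntegral x) h (by simp [sineIntegral_zero])
      (by simp [sine_zero])

end IsCosineFunction

namespace IsGeneratorOf

theorem mem_graph_of_commute (hK : IsGeneratorOf K C) (P : E →L[ℂ] E)
    (hP : ∀ t x, C t (P x) = P (C t x)) {x y : E} (h : (x, y) ∈ K.graph) :
    (P x, P y) ∈ K.graph := by
  rw [hK] at h ⊢
  refine ((P.continuous.tendsto y).comp h).congr fun t => ?_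
  simp [hP]

theorem cosine_mem_graph (hK : IsGeneratorOf K C) (hC : IsCosineFunction C) (t : ℝ) {x y : E}
    (h : (x, y) ∈ K.graph) : (C t x, C t y) ∈ K.graph :=
  hK.mem_graph_of_commute (C t) (fun s z => hC.commute s t z) h

variable [CompleteSpace E]

theorem sine_mem_graph (hK : IsGeneratorOf K C) (hC : IsCosineFunction C) (t : ℝ) {x y : E}
    (h : (x, y) ∈ K.graph) : (hC.sine t x, hC.sine t y) ∈ K.graph :=
  hK.mem_graph_of_commute (hC.sine t) (fun s z => hC.sine_comm s t z) h

/-- The swap identity reads $J(t)(C(s)x-x)=(C(t)-I)J(s)x$. Multiplied by $2/s^2$, as $s\to0$ the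
sides tend to $J(t)y$ and $C(t)x-x$. -/
theorem apply_eq_add_sineIntegral (hK : IsGeneratorOf K C) (hC : IsCosineFunction C) (t : ℝ)
    {x y : E} (h : (x, y) ∈ K.graph) : C t x = x + hC.sineIntegral t y := by
  rw [hK] at h
  have h1 := ((hC.sineIntegral t).continuous.tendsto y).comp h
  have h2 : Tendsto (fun s : ℝ => C t (((2 / s ^ 2 : ℝ) : ℂ) • hC.sineIntegral s x) -
      ((2 / s ^ 2 : ℝ) : ℂ) • hC.sineIntegral s x) (𝓝[≠] 0) (𝓝 (C t x - x)) :=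
    (((C t).continuous.tendsto x).comp (hC.tendsto_sineIntegral x)).sub
      (hC.tendsto_sineIntegral x)
  have h3 := tendsto_nhds_unique h1 (h2.congr fun s => ?_)
  · rw [h3]; abel
  · have := hC.sineIntegral_swap t s x
    rw [Function.comp_apply, map_smul, map_smul, map_sub, ← hC.sineIntegral_comm, ← smul_sub]
    congr 1
    rw [sub_eq_sub_iff_add_eq_add, add_comm, this, add_comm]

theorem hasDerivAt_cosine (hK : IsGeneratorOf K C) (hC : IsCosineFunction C) (t : ℝ) {x y : E}
    (h : (x, y) ∈ K.graph) : HasDerivAt (fun s => C s x) (hC.sine t y) t := by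
  have : (fun s => C s x) = fun s => x + hC.sineIntegral s y :=
    funext fun s => hK.apply_eq_add_sineIntegral hC s h
  rw [this]
  exact (hC.hasDerivAt_sineIntegral y t).const_add x

/-- Uniqueness for the second order Cauchy problem governed by a generator. -/
theorem eq_zero_of_second_order (hK : IsGeneratorOf K C) (hC : IsCosineFunction C)
    {D D' D'' : ℝ → E} (hD : ∀ t, HasDerivAt D (D' t) t) (hD' : ∀ t, HasDerivAt D' (D'' t) t)
    (hmem : ∀ t, (D t, D'' t) ∈ K.graph) (h0 : D 0 = 0) (h0' : D' 0 = 0) (t : ℝ) : D t = 0 := by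
  have hCt : ∀ x, Continuous fun s => C (t - s) x := fun x =>
    (hC.strongly_continuous x).comp (continuous_const.sub continuous_id)
  have hSt : ∀ x, Continuous fun s => hC.sine (t - s) x := fun x =>
    (hC.sine_continuous x).comp (continuous_const.sub continuous_id)
  -- Variation of constants: the four terms of the derivative cancel by $D''=KD$. The expression
  -- vanishes at $s=0$ and equals $D(t)$ at $s=t$.
  have key : ∀ s, HasDerivAt (fun s => C (t - s) (D s) + hC.sine (t - s) (D' s)) 0 s := fun s => by
    have h1 := hasDerivAt_apply_curve hCt (hD s)
      (HasDerivAt.comp_const_sub t s (hK.hasDerivAt_cosine hC (t - s) (hmem s)))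
    have h2 := hasDerivAt_apply_curve hSt (hD' s)
      (HasDerivAt.comp_const_sub t s (hC.hasDerivAt_sine (D' s) (t - s)))
    exact (h1.add h2).congr_deriv (by abel)
  have := eq_zero_of_hasDerivAt_zero key (by simp [h0, h0']) t
  simpa [hC.zero, hC.sine_zero] using this

end IsGeneratorOf

end CosineTheory

end SecondOrderBVP

namespace SecondOrderBVP

/-! ### Twice differentiable curves. -/

section CurveLemmas

theorem contDiff_two_of_hasDerivAt {F : Type*} [NormedAddCommGroup F] [NormedSpace ℝ F]
    {f f' f'' : ℝ → F} (hf : ∀ t, HasDerivAt f (f' t) t) (hf' : ∀ t, HasDerivAt f' (f'' t) t)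
    (hc : Continuous f'') : ContDiff ℝ 2 f := by
  have h1 : deriv f = f' := funext fun t => (hf t).deriv
  have h2 : deriv f' = f'' := funext fun t => (hf' t).deriv
  have h3 : ContDiff ℝ 1 f' :=
    contDiff_one_iff_deriv.2 ⟨fun t => (hf' t).differentiableAt, h2 ▸ hc⟩
  exact (contDiff_succ_iff_deriv (n := 1)).2
    ⟨fun t => (hf t).differentiableAt, fun h => by simp at h, h1 ▸ h3⟩

theorem hasDerivAt_of_contDiff_two {F : Type*} [NormedAddCommGroup F] [NormedSpace ℝ F]
    {f : ℝ → F} (hf : ContDiff ℝ 2 f) :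
    (∀ t, HasDerivAt f (deriv f t) t) ∧ ∀ t, HasDerivAt (deriv f) (deriv (deriv f) t) t := by
  have h := (contDiff_succ_iff_deriv (n := 1)).1 hf
  exact ⟨fun t => (h.1 t).hasDerivAt,
    fun t => ((h.2.2.differentiable one_ne_zero) t).hasDerivAt⟩

theorem hasDerivAt_subtype_mk {F : Type*} [NormedAddCommGroup F] [NormedSpace ℂ F]
    {S : Submodule ℂ F} {f : ℝ → F} {f' : F} {t : ℝ} (hf : HasDerivAt f f' t)
    (h : ∀ s, f s ∈ S) (h' : f' ∈ S) :
    HasDerivAt (fun s => (⟨f s, h s⟩ : S)) ⟨f', h'⟩ t := by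
  rw [hasDerivAt_iff_tendsto_slope] at hf ⊢
  exact tendsto_subtype_rng.2 hf

end CurveLemmas

/-! ### Domains, orbits and the embedding into `Y`. -/

section Domains

variable {X Y bX : Type*}
  [NormedAddCommGroup X] [NormedSpace ℂ X]
  [NormedAddCommGroup Y] [NormedSpace ℂ Y]
  [NormedAddCommGroup bX] [NormedSpace ℂ bX]

theorem mem_domInfty_of_orbit {A : X →ₗ.[ℂ] X} {a : ℕ → X}
    (ha : ∀ n, ∃ h : a n ∈ A.domain, A ⟨a n, h⟩ = a (n + 1)) : a 0 ∈ domInfty A := by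
  -- Membership and value are proved together, as the domain of each power depends on the value of
  -- the preceding one.
  have key : ∀ n, ∃ h : a 0 ∈ (opPow A n).domain, opPow A n ⟨a 0, h⟩ = a n := by
    intro n
    induction n with
    | zero => exact ⟨trivial, rfl⟩
    | succ n ih =>
      obtain ⟨h, hn⟩ := ih
      obtain ⟨h1, h2⟩ := ha n
      have h3 : opPow A n ⟨a 0, h⟩ ∈ A.domain := hn ▸ h1
      refine ⟨⟨h, h3⟩, ?_⟩
      change A ⟨opPow A n ⟨a 0, h⟩, h3⟩ = a (n + 1)
      rw [← h2]
      exact congrArg A (Subtype.ext hn)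
  exact Submodule.mem_iInf _ |>.2 fun n => (key n).1

theorem mem_graph_opMatrix_iff {A : X →ₗ.[ℂ] X} {L B : A.domain →ₗ[ℂ] bX} {Bt : bX →L[ℂ] bX}
    {p q : X × bX} :
    (p, q) ∈ (opMatrix A L B Bt).graph ↔
      ∃ h : p.1 ∈ A.domain, L ⟨p.1, h⟩ = p.2 ∧ A ⟨p.1, h⟩ = q.1 ∧
        B ⟨p.1, h⟩ + Bt p.2 = q.2 := by
  rw [LinearPMap.mem_graph_iff]
  constructor
  · rintro ⟨⟨y, hy⟩, h1, h2⟩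
    have h1 : y = p := h1
    subst h1
    have h2 : (A ⟨y.1, hy.1⟩, B ⟨y.1, hy.1⟩ + Bt y.2) = q := h2
    subst h2
    exact ⟨hy.1, hy.2, rfl, rfl⟩
  · rintro ⟨h, h1, h2, h3⟩
    exact ⟨⟨p, h, h1⟩, rfl, Prod.ext h2 h3⟩

theorem exists_orbit_of_mem_regularData {A : X →ₗ.[ℂ] X} {L B : A.domain →ₗ[ℂ] bX}
    (Bt : bX →L[ℂ] bX) {f : X} (hf : f ∈ regularData A L B) :
    ∃ F : ℕ → X × bX, F 0 = (f, 0) ∧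
      ∀ n, (F n, F (n + 1)) ∈ (opMatrix A L B Bt).graph := by
  refine ⟨fun n => (opPow A n ⟨f, Submodule.mem_iInf _ |>.1 hf.1 n⟩, 0), rfl, fun n => ?_⟩
  obtain ⟨hn, h, hL, hB⟩ := hf.2 n
  exact mem_graph_opMatrix_iff.2 ⟨h, hL, rfl, by simp [hB]⟩

/-- The domain of `A`, with the graph norm of `(A, L)`, embeds continuously into `Y`. -/
theorem exists_continuous_lift [CompleteSpace X] [CompleteSpace Y] [CompleteSpace bX]
    (ι : Y →L[ℂ] X) (hι : Function.Injective ι) (A : X →ₗ.[ℂ] X) (L : A.domain →ₗ[ℂ] bX)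
    (hAY : ∀ u ∈ A.domain, ∃ y : Y, ι y = u) (hAL : (stacked A L).IsClosed) :
    ∃ T : (stacked A L).graph →L[ℂ] Y, ∀ p, ι (T p) = p.1.1 := by
  have hmem : ∀ p : (stacked A L).graph, ∃ y : Y, ι y = p.1.1 := fun p => by
    obtain ⟨u, hu, -⟩ := LinearPMap.mem_graph_iff _ |>.1 p.2
    exact hAY _ (hu ▸ u.2)
  choose T hT using hmem
  let T' : (stacked A L).graph →ₗ[ℂ] Y :=
    { toFun := T
      map_add' := fun p q => hι (by simp [hT])
      map_smul' := fun c p => hι (by simp [hT]) }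
  have : CompleteSpace (stacked A L).graph := hAL.completeSpace_coe
  -- The graph is closed because limits in `X` are unique and `ι` is injective.
  refine ⟨⟨T', T'.continuous_of_seq_closed_graph fun p x y hp hy => hι ?_⟩, hT⟩
  have h1 : Tendsto (fun n => ι (T (p n))) atTop (𝓝 (ι y)) := (ι.continuous.tendsto y).comp hy
  have h2 : Tendsto (fun n => (p n).1.1) atTop (𝓝 x.1.1) :=
    ((continuous_fst.comp continuous_subtype_val).tendsto x).comp hp
  simp only [hT] at h1
  exact (tendsto_nhds_unique h1 h2).trans (hT x).symm

theorem mem_graph_stacked_of_mem_graph_opMatrix {A : X →ₗ.[ℂ] X} {L B : A.domain →ₗ[ℂ] bX}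
    {Bt : bX →L[ℂ] bX} {p q : X × bX} (h : (p, q) ∈ (opMatrix A L B Bt).graph) :
    (p.1, q.1, p.2) ∈ (stacked A L).graph := by
  obtain ⟨h, h1, h2, -⟩ := mem_graph_opMatrix_iff.1 h
  exact LinearPMap.mem_graph_iff _ |>.2 ⟨⟨p.1, h⟩, rfl, Prod.ext h2 h1⟩

end Domains

/-! ### Smooth orbits of the Cauchy problem. -/

section Smooth

variable {E : Type*} [NormedAddCommGroup E] [NormedSpace ℂ E] [CompleteSpace E]

/-- For initial data in `D(K^∞)` the second order Cauchy problem has a solution all of whose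
images under powers of `K` solve it as well. -/
theorem exists_smooth_orbit {K : E →ₗ.[ℂ] E} (hK : GeneratesCosine K) {F G : ℕ → E}
    (hF : ∀ n, (F n, F (n + 1)) ∈ K.graph) (hG : ∀ n, (G n, G (n + 1)) ∈ K.graph) :
    ∃ U V : ℕ → ℝ → E, (∀ n t, HasDerivAt (U n) (V n t) t) ∧
      (∀ n t, HasDerivAt (V n) (U (n + 1) t) t) ∧
      (∀ n t, (U n t, U (n + 1) t) ∈ K.graph) ∧
      (∀ n t, (V n t, V (n + 1) t) ∈ K.graph) ∧ U 0 0 = F 0 ∧ V 0 0 = G 0 := by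
  obtain ⟨C, hC, hK⟩ := hK
  refine ⟨fun n t => C t (F n) + hC.sine t (G n), fun n t => hC.sine t (F (n + 1)) + C t (G n),
    fun n t => ?_, fun n t => ?_, fun n t => ?_, fun n t => ?_, ?_, ?_⟩
  · exact (hK.hasDerivAt_cosine hC t (hF n)).add (hC.hasDerivAt_sine _ t)
  · exact (hC.hasDerivAt_sine _ t).add (hK.hasDerivAt_cosine hC t (hG n))
  · exact K.graph.add_mem (hK.cosine_mem_graph hC t (hF n)) (hK.sine_mem_graph hC t (hG n))
  · exact K.graph.add_mem (hK.sine_mem_graph hC t (hF (n + 1))) (hK.cosine_mem_graph hC t (hG n))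
  · simp [hC.zero, hC.sine_zero]
  · simp [hC.zero, hC.sine_zero]

end Smooth

/-! ### From the operator matrix to classical solutions. -/

section Solutions

variable {X Y bX : Type*}
  [NormedAddCommGroup X] [NormedSpace ℂ X]
  [NormedAddCommGroup Y] [NormedSpace ℂ Y]
  [NormedAddCommGroup bX] [NormedSpace ℂ bX]
  {ι : Y →L[ℂ] X} {A : X →ₗ.[ℂ] X} {L B : A.domain →ₗ[ℂ] bX} {Bt : bX →L[ℂ] bX}
  {f g : X} {h j : bX}

/-- A classical solution, paired with its boundary values, solves the Cauchy problem for the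
operator matrix. -/
theorem IsClassicalSolution.exists_pair {u : ℝ → X}
    (hu : IsClassicalSolution ι A L B Bt f g h j u) :
    ∃ W W' W'' : ℝ → X × bX, (∀ t, (W t).1 = u t) ∧ (∀ t, HasDerivAt W (W' t) t) ∧
      (∀ t, HasDerivAt W' (W'' t) t) ∧ (∀ t, (W t, W'' t) ∈ (opMatrix A L B Bt).graph) ∧
      W 0 = (f, h) ∧ W' 0 = (g, j) := by
  obtain ⟨h1, h2⟩ := hasDerivAt_of_contDiff_two hu.contDiff
  obtain ⟨h3, h4⟩ := hasDerivAt_of_contDiff_two hu.contDiff_L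
  refine ⟨_, _, _, fun t => rfl, fun t => (h1 t).prodMk (h3 t), fun t => (h2 t).prodMk (h4 t),
    fun t => ?_, Prod.ext hu.init_u hu.init_x, Prod.ext hu.init_du hu.init_dx⟩
  exact mem_graph_opMatrix_iff.2
    ⟨hu.mem_domain t, rfl, (hu.eq_interior t).symm, (hu.eq_boundary t).symm⟩

theorem IsClassicalSolution.unique [CompleteSpace X] [CompleteSpace bX]
    (hcos : GeneratesCosine (opMatrix A L B Bt)) {u v : ℝ → X}
    (hu : IsClassicalSolution ι A L B Bt f g h j u)
    (hv : IsClassicalSolution ι A L B Bt f g h j v) : v = u := by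
  obtain ⟨C, hC, hK⟩ := hcos
  obtain ⟨W, W', W'', hWu, hW, hW', hWm, hW0, hW0'⟩ := hu.exists_pair
  obtain ⟨Z, Z', Z'', hZv, hZ, hZ', hZm, hZ0, hZ0'⟩ := hv.exists_pair
  funext t
  have := hK.eq_zero_of_second_order hC (fun t => (hZ t).sub (hW t))
    (fun t => (hZ' t).sub (hW' t)) (fun t => Submodule.sub_mem _ (hZm t) (hWm t))
    (by simp [hZ0, hW0]) (by simp [hZ0', hW0']) t
  rw [← hZv, ← hWu, sub_eq_zero.1 this]

theorem isClassicalSolution_of_orbit [CompleteSpace X] [CompleteSpace Y] [CompleteSpace bX]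
    (hι : Function.Injective ι) (hAY : ∀ u ∈ A.domain, ∃ y : Y, ι y = u)
    (hAL : (stacked A L).IsClosed) {U V : ℕ → ℝ → X × bX}
    (hU : ∀ n t, HasDerivAt (U n) (V n t) t) (hV : ∀ n t, HasDerivAt (V n) (U (n + 1) t) t)
    (hUm : ∀ n t, (U n t, U (n + 1) t) ∈ (opMatrix A L B Bt).graph)
    (hVm : ∀ n t, (V n t, V (n + 1) t) ∈ (opMatrix A L B Bt).graph)
    (hU0 : U 0 0 = (f, h)) (hV0 : V 0 0 = (g, j)) :
    IsClassicalSolution ι A L B Bt f g h j fun t => (U 0 t).1 := by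
  have hUc : ∀ n, Continuous (U n) := fun n =>
    continuous_iff_continuousAt.2 fun t => (hU n t).continuousAt
  have hVc : ∀ n, Continuous (V n) := fun n =>
    continuous_iff_continuousAt.2 fun t => (hV n t).continuousAt
  have hU1 : ∀ n t, HasDerivAt (fun s => (U n s).1) (V n t).1 t := fun n t => (hU n t).fst
  have hU2 : ∀ n t, HasDerivAt (fun s => (U n s).2) (V n t).2 t := fun n t => (hU n t).snd
  have hV1 : ∀ n t, HasDerivAt (fun s => (V n s).1) (U (n + 1) t).1 t := fun n t => (hV n t).fst
  have hV2 : ∀ n t, HasDerivAt (fun s => (V n s).2) (U (n + 1) t).2 t := fun n t => (hV n t).snd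
  have hdom : ∀ t, (U 0 t).1 ∈ A.domain := fun t => (mem_graph_opMatrix_iff.1 (hUm 0 t)).1
  have hLU : (fun t => L ⟨(U 0 t).1, hdom t⟩) = fun t => (U 0 t).2 :=
    funext fun t => (mem_graph_opMatrix_iff.1 (hUm 0 t)).2.1
  have hd1 : deriv (fun t => (U 0 t).1) = fun t => (V 0 t).1 := funext fun t => (hU1 0 t).deriv
  have hd2 : deriv (fun t => (U 0 t).2) = fun t => (V 0 t).2 := funext fun t => (hU2 0 t).deriv
  refine
    { contDiff := contDiff_two_of_hasDerivAt (hU1 0) (hV1 0) (hUc 1).fst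
      contDiff_Y := ?_
      mem_domain := hdom
      contDiff_L := ?_
      eq_interior := fun t => ?_
      eq_boundary := fun t => ?_
      init_u := by simp [hU0]
      init_du := by rw [hd1]; simp [hV0]
      init_x := by rw [congrFun hLU 0, hU0]
      init_dx := by rw [hLU, hd2]; simp [hV0] }
  · obtain ⟨T, hT⟩ := exists_continuous_lift ι hι A L hAY hAL
    have hUs := fun t => mem_graph_stacked_of_mem_graph_opMatrix (hUm 0 t)
    have hVs := fun t => mem_graph_stacked_of_mem_graph_opMatrix (hVm 0 t)
    refine ⟨fun t => T ⟨_, hUs t⟩, ?_, fun t => hT _⟩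
    -- The derivative of $(u,Au,Lu)$ lies in the graph again because $V_1=\mathcal AV_0$; this makes
    -- the curve differentiable in the graph norm, and the bounded `T` carries it to `Y`.
    have hder : ∀ t, HasDerivAt (fun t => T ⟨_, hUs t⟩) (T ⟨_, hVs t⟩) t := fun t =>
      (T.restrictScalars ℝ).hasFDerivAt.comp_hasDerivAt t (hasDerivAt_subtype_mk
        ((hU1 0 t).prodMk ((hU1 1 t).prodMk (hU2 0 t))) hUs (hVs t))
    refine contDiff_one_iff_deriv.2 ⟨fun t => (hder t).differentiableAt, ?_⟩
    rw [funext fun t => (hder t).deriv]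
    exact T.continuous.comp
      (((hVc 0).fst.prodMk ((hVc 1).fst.prodMk (hVc 0).snd)).subtype_mk _)
  · rw [hLU]
    exact contDiff_two_of_hasDerivAt (hU2 0) (hV2 0) (hUc 1).snd
  · rw [hd1, (hV1 0 t).deriv]
    exact (mem_graph_opMatrix_iff.1 (hUm 0 t)).2.2.1.symm
  · rw [hLU, hd2, (hV2 0 t).deriv, congrFun hLU t]
    exact (mem_graph_opMatrix_iff.1 (hUm 0 t)).2.2.2.symm

end Solutions

end SecondOrderBVP

theorem proposition6p6
    {X Y bX : Type*}
    [NormedAddCommGroup X] [NormedSpace ℂ X] [CompleteSpace X]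
    [NormedAddCommGroup Y] [NormedSpace ℂ Y] [CompleteSpace Y]
    [NormedAddCommGroup bX] [NormedSpace ℂ bX] [CompleteSpace bX]
    -- the Banach space `Y`, continuously embedded into `X`
    (ι : Y →L[ℂ] X) (hι : Function.Injective ι)
    -- the operators `A`, `L`, `B` with domain `D(A)`, and `B̃` on the boundary space
    (A : X →ₗ.[ℂ] X) (L B : A.domain →ₗ[ℂ] bX) (Bt : bX →L[ℂ] bX)
    (hAY : ∀ u ∈ A.domain, ∃ y : Y, ι y = u)
    (hL : Function.Surjective L)
    (hA₀_closed : (SecondOrderBVP.restrictKer A L).IsClosed)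
    (hA₀_dense : Dense ((SecondOrderBVP.restrictKer A L).domain : Set X))
    (hA₀_res : ∃ lam : ℂ, SecondOrderBVP.IsInResolventSet (SecondOrderBVP.restrictKer A L) lam)
    (hAL : (SecondOrderBVP.stacked A L).IsClosed)
    -- `B` is bounded with respect to the graph norm of `u ↦ (A u, L u)`
    (hB : ∃ c : ℝ, ∀ u : A.domain, ‖B u‖ ≤ c * (‖(u : X)‖ + ‖A u‖ + ‖L u‖))
    (hcos : SecondOrderBVP.GeneratesCosine (SecondOrderBVP.opMatrix A L B Bt))
    (f g : X) (hf : f ∈ SecondOrderBVP.regularData A L B)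
    (hg : g ∈ SecondOrderBVP.regularData A L B) :
    ∃ u : ℝ → X,
      SecondOrderBVP.IsClassicalSolution ι A L B Bt f g 0 0 u ∧
      (∀ v : ℝ → X, SecondOrderBVP.IsClassicalSolution ι A L B Bt f g 0 0 v → v = u) ∧
      ∀ t : ℝ, u t ∈ SecondOrderBVP.domInfty A := by
  obtain ⟨F, hF0, hF⟩ := SecondOrderBVP.exists_orbit_of_mem_regularData Bt hf
  obtain ⟨G, hG0, hG⟩ := SecondOrderBVP.exists_orbit_of_mem_regularData Bt hg
  obtain ⟨U, V, hU, hV, hUm, hVm, hU0, hV0⟩ := SecondOrderBVP.exists_smooth_orbit hcos hF hG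
  have hsol := SecondOrderBVP.isClassicalSolution_of_orbit hι hAY hAL hU hV hUm hVm
    (hU0.trans hF0) (hV0.trans hG0)
  refine ⟨_, hsol, fun v hv => hsol.unique hcos hv, fun t => ?_⟩
  refine SecondOrderBVP.mem_domInfty_of_orbit (a := fun n => (U n t).1) fun n => ?_
  obtain ⟨h, -, hA, -⟩ := SecondOrderBVP.mem_graph_opMatrix_iff.1 (hUm n t)
  exact ⟨h, hA⟩
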